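/- **Setting.** Let $d\in\{1,2\}$, $\mathbb T^d=\mathbb R^d/\mathbb Z^d$, and let $H:\mathbb T^d\to(0,\infty)$ be smooth. Put $\omega_0=\{(x,y)\in\mathbb T^d\times\mathbb R:\ 0<y<1\}$ and $\Omega=\{(X,Y)\in\mathbb T^d\times\mathbb R:\ Y>-H(X)\}$. Let $\mathrm{Re},\mathrm{We}\ge 0$, $r\in[0,1]$, $D>0$, $\alpha\in[-1,1]$, and let $f:\mathbb T^d\times\mathbb R\to\mathbb R^{d+1}$. For a velocity $u$, let $(\nabla u)_{ij}=\partial_ju_i$, let $\mathbb D(u)$ and $\mathbb W(u)$ be the symmetric and skew-symmetric parts of $\nabla u$, and let $g_\alpha(\nabla u,\sigma)=\sigma\mathbb W(u)-\mathbb W(u)\sigma-\alpha(\sigma\mathbb D(u)+\mathbb D(u)\sigma)$. Functions $u_k$ (vectors in $\mathbb R^{d+1}$), $p_k$ (scalars), $\sigma_k$ (symmetric $(d+1)\times(d+1)$ matrices) depend on $(x,y)$. Functions $U_k,P_k,\Sigma_k$ of the same types depend on $(X,Y)\in\overline\Omega$, with the macroscopic variable $(x,y)$, $0\le y\le1$,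 as a parameter. For the latter $\nabla,\operatorname{div},\Delta,\mathbb D$ act on $(X,Y)$, while $\nabla_x=(\partial_{x_1},\dots,\partial_{x_d},0)$, $\Delta_x=\sum_{\ell\le d}\partial_{x_\ell}^2$, $\operatorname{div}_x$, $\mathbb D_x$ act on $x$ only. The $a_k$ (vectors) and $b_k$ (matrices) depend on $(x,y)$ only and are constant in $(X,Y)$. By convention $U_0=0$ and $\Sigma_0=0$. **Elementary problems.** The main problem of order $k\ge0$ is $$\left\{\begin{array}{ll}\mathrm{Re}\sum_{i=0}^{k}u_i\cdot\nabla u_{k-i}-(1-r)\Delta u_k+\nabla p_k=\operatorname{div}\sigma_k+\delta_{k0}f+a_k,\quad \operatorname{div}u_k=0&\text{on }\omega_0,\\ \mathrm{We}\sum_{i=0}^{k}\bigl(u_i\cdot\nabla\sigma_{k-i}+g_\alpha(\nabla u_i,\sigma_{k-i})\bigr)+\sigma_k-D\Delta\sigma_k=2r\,\mathbb D(u_k)&\text{on }\omega_0,\\ u_k=-\lim_{Y\to\infty}\int_{\mathbb T^d}U_k\,dX,\quad \partial_y\sigma_k=0&\text{on }y=1,\\ u_k=0,\quad -\partial_y\sigma_k=b_k&\text{on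 }y=0.\end{array}\right.$$ The boundary layer problem of order $k\ge1$ is, for every $(x,y)$ with $0\le y\le 1$, $$\left\{\begin{array}{ll}-(1-r)\Delta U_k+\nabla P_k=F_k-a_{k-2},\quad \operatorname{div}U_k=0,\quad -D\Delta\Sigma_k=G_k&\text{on }\Omega,\\ U_k=D_k,\quad -\sum_{\ell\le d}\partial_{\ell}H\,\partial_{X_\ell}\Sigma_k-\partial_Y\Sigma_k=N_k-b_{k-1}&\text{on }Y=-H(X),\end{array}\right.$$ where the right-hand sides $F_1-a_{-1}$ and $G_1$ are $0$ and, for $k\ge2$, $$\begin{aligned}F_k={}&\operatorname{div}\Sigma_{k-1}+2(1-r)\nabla_x\!\cdot\!\nabla U_{k-1}+(1-r)\Delta_xU_{k-2}-\nabla_xP_{k-1}+\operatorname{div}_x\Sigma_{k-2}\\&-\mathrm{Re}\sum_{i=0}^{k-2}\Bigl((u_i+U_i)\cdot(\nabla U_{k-1-i}+\nabla_xU_{k-2-i})+U_i\cdot\nabla u_{k-2-i}\Bigr),\\ G_k={}&2r\,\mathbb D(U_{k-1})+2r\,\mathbb D_x(U_{k-2})-\Sigma_{k-2}+2D\,\nabla_x\!\cdot\!\nabla\Sigma_{k-1}+D\Delta_x\Sigma_{k-2}\\&-\mathrm{We}\sum_{i=0}^{k-2}\Bigl(u_i\cdot(\nabla\Sigma_{k-1-i}+\nabla_x\Sigma_{k-2-i})+U_i\cdot(\nabla\sigma_{k-2-i}+\nabla\Sigma_{k-1-i}+\nabla_x\Sigma_{k-2-i})\\&\qquad+g_\alpha(\nabla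 u_i,\Sigma_{k-2-i})+g_\alpha(\nabla U_{i+1}+\nabla_xU_i,\sigma_{k-2-i}+\Sigma_{k-2-i})\Bigr),\end{aligned}$$ and, for $k\ge1$, with macroscopic fields evaluated at $y=0$, $$\begin{aligned}D_k&=-\sum_{q=1}^{k}\tfrac{(-1)^q}{q!}H^q\,\partial_y^qu_{k-q}\big|_{y=0},\\ N_k&=(\nabla H\cdot\nabla_x)\sigma_{k-1}\big|_{y=0}+(\nabla H\cdot\nabla_x)\Sigma_{k-1}+\sum_{q=1}^{k-1}\tfrac{(-1)^q}{q!}H^q\,\partial_y^q\bigl((\nabla H\cdot\nabla_x)\sigma_{k-1-q}+\partial_y\sigma_{k-1-q}\bigr)\big|_{y=0}.\end{aligned}$$ Solutions are smooth up to the boundary (jointly in all variables for the boundary layer problems) and periodic. A solution of a boundary layer problem is moreover a strong solution: for each $(x,y)$, $\nabla U_k\in H^1(\Omega)$, $P_k\in H^1(\Omega)$, $\Sigma_k\in H^2(\Omega)$, and the same holds for its derivatives $\partial_{x_\ell}(U_k,P_k,\Sigma_k)$, $\ell\le d$. **Statement.** Let $k\ge0$. Suppose that $(u_n,p_n,\sigma_n)$,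 $0\le n\le k$, and $(U_n,P_n,\Sigma_n)$, $1\le n\le k+1$, solve the elementary problems of the corresponding orders, and that $a_n=\lim_{Y\to+\infty}\int_{\mathbb T^d}F_{n+2}(X,Y)\,dX$ for $0\le n\le k$ (for every $(x,y)$, $0\le y\le1$; in particular these limits exist). Then, for every $(x,y)$ with $0\le y\le 1$, the following limit exists and $$a_k=\lim_{Y\to+\infty}\int_{\mathbb T^d}\Bigl[-\mathrm{Re}\,u_0\cdot\nabla_xU_k+(1-r)\Delta_xU_k-\mathrm{Re}\sum_{i=1}^{k-1}u_i\cdot\nabla_xU_{k-i}-\mathrm{Re}\sum_{i=1}^{k}U_i\cdot(\nabla_xU_{k-i}+\nabla u_{k-i})\Bigr]dX .$$ Consequently $a_k$ depends only on already computed elementary solutions: if two such families (with the same $\mathrm{Re},\mathrm{We},r,D,\alpha,H,f$) have the same $u_i$ for $i<k$ on $\omega_0$ and the same $U_i$ for $i\le k$ on $\omega_0\times\Omega$, then they have the same $a_k$ on $\omega_0$. -/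

import Mathlib

open Filter Topology MeasureTheory
open scoped ContDiff

/-! ### Points, derivatives, the torus, Sobolev norms -/

/-- A point `(x, y)` (macroscopic) or `(X, Y)` (microscopic) of `ℝ^d × ℝ`. The torus `𝕋^d` is
`ℝ^d / ℤ^d`; functions on it are `ℤ^d`-periodic functions on `ℝ^d`. -/
abbrev Pt (d : ℕ) : Type := (Fin d → ℝ) × ℝ

/-- A scalar field of the macroscopic variable `(x, y)`. -/
abbrev MacroField (d : ℕ) : Type := Pt d → ℝ

/-- A scalar boundary layer field `V m z`, with `m = (x, y)` the macroscopic variable (a parameter)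
and `z = (X, Y)` the microscopic one. -/
abbrev LayerField (d : ℕ) : Type := Pt d → Pt d → ℝ

/-- The `i`-th coordinate vector of `ℝ^d × ℝ`; the last one is the vertical direction. -/
def dir {d : ℕ} (i : Fin (d + 1)) : Pt d :=
  Fin.lastCases ((0 : Fin d → ℝ), (1 : ℝ)) (fun l => (Pi.single l (1 : ℝ), (0 : ℝ))) i

/-- The `i`-th partial derivative. -/
noncomputable def pd {d : ℕ} (i : Fin (d + 1)) (g : Pt d → ℝ) : Pt d → ℝ :=
  fun z => fderiv ℝ g z (dir i)

/-- The `i`-th component of the microscopic gradient `∇V = (∂_{X_1} V, …, ∂_{X_d} V, ∂_Y V)`. -/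
noncomputable def pdMic {d : ℕ} (i : Fin (d + 1)) (V : LayerField d) : LayerField d :=
  fun m z => pd i (V m) z

/-- The `i`-th component of `∇_x V = (∂_{x_1} V, …, ∂_{x_d} V, 0)`. -/
noncomputable def pdX {d : ℕ} (i : Fin (d + 1)) (V : LayerField d) : LayerField d :=
  fun m z => if i = Fin.last d then 0 else pd i (fun m' => V m' z) m

/-- `∫_{𝕋^d} g(X) dX`, as the integral over the unit cell. -/
noncomputable def torusInt {d : ℕ} (g : (Fin d → ℝ) → ℝ) : ℝ :=
  ∫ X in Set.Icc (0 : Fin d → ℝ) 1, g X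

/-- `ℤ^d`-periodicity in the first variable. -/
def PeriodicPt {d : ℕ} (g : Pt d → ℝ) : Prop :=
  ∀ (n : Fin d → ℤ) (z : Pt d), g (fun l => z.1 l + n l, z.2) = g z

/-- The closed strip `0 ≤ y ≤ 1`, closure of the smooth domain. -/
def closedStrip (d : ℕ) : Set (Pt d) := {m | 0 ≤ m.2 ∧ m.2 ≤ 1}

/-- The smooth domain `ω₀ : 0 < y < 1`. -/
def omegaZero (d : ℕ) : Set (Pt d) := {m | 0 < m.2 ∧ m.2 < 1}

/-- The roughness profile: a smooth positive function on the torus. -/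
structure IsRoughness {d : ℕ} (H : (Fin d → ℝ) → ℝ) : Prop where
  smooth : ContDiff ℝ ∞ H
  pos : ∀ X, 0 < H X
  periodic : ∀ (n : Fin d → ℤ) (X : Fin d → ℝ), H (fun l => X l + n l) = H X

/-- The boundary layer domain `Ω : Y > -H(X)`. -/
def layerDomain {d : ℕ} (H : (Fin d → ℝ) → ℝ) : Set (Pt d) := {z | -H z.1 < z.2}

/-- One period of the boundary layer domain. -/
def layerCell {d : ℕ} (H : (Fin d → ℝ) → ℝ) : Set (Pt d) :=
  {z | z.1 ∈ Set.Icc (0 : Fin d → ℝ) 1 ∧ -H z.1 < z.2}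

/-- For a smooth `g`: all partial derivatives of `g` of order at most `n` are in `L²(Ω)`, that is,
`g ∈ H^n(Ω)`. -/
def InSobolev {d : ℕ} (H : (Fin d → ℝ) → ℝ) : ℕ → (Pt d → ℝ) → Prop
  | 0, g => MemLp g 2 (volume.restrict (layerCell H))
  | n + 1, g => MemLp g 2 (volume.restrict (layerCell H)) ∧ ∀ i, InSobolev H n (pd i g)

/-! ### Physical parameters and differential operators -/

/-- Reynolds number `Re`, Weissenberg number `We`, relaxation parameter `r`, diffusion
coefficient `D`, and the interpolation parameter `a` of the Oldroyd derivative (`slip`). -/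
structure FlowParams where
  Re : ℝ
  We : ℝ
  r : ℝ
  D : ℝ
  slip : ℝ
  Re_nonneg : 0 ≤ Re
  We_nonneg : 0 ≤ We
  r_nonneg : 0 ≤ r
  r_le_one : r ≤ 1
  D_pos : 0 < D
  slip_ge : -1 ≤ slip
  slip_le : slip ≤ 1

/-- `v · ∇g` for a macroscopic field `g`. -/
noncomputable def adv {d : ℕ} (v : Fin (d + 1) → ℝ) (g : MacroField d) (m : Pt d) : ℝ :=
  ∑ q, v q * pd q g m

/-- The Laplacian. -/
noncomputable def lap {d : ℕ} (g : Pt d → ℝ) (m : Pt d) : ℝ := ∑ q, pd q (pd q g) m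

/-- `v · ∇V`, with the microscopic gradient. -/
noncomputable def advMic {d : ℕ} (v : Fin (d + 1) → ℝ) (V : LayerField d) (m z : Pt d) : ℝ :=
  ∑ q, v q * pdMic q V m z

/-- `v · ∇_x V`. -/
noncomputable def advX {d : ℕ} (v : Fin (d + 1) → ℝ) (V : LayerField d) (m z : Pt d) : ℝ :=
  ∑ q, v q * pdX q V m z

/-- `Δ_x V`. -/
noncomputable def lapX {d : ℕ} (V : LayerField d) (m z : Pt d) : ℝ :=
  ∑ q, pdX q (pdX q V) m z

/-- `∇_x · ∇V`. -/
noncomputable def mixedLap {d : ℕ} (V : LayerField d) (m z : Pt d) : ℝ :=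
  ∑ q, pdX q (pdMic q V) m z

/-- The velocity gradient `(∇u)_{ij} = ∂_j u_i`. -/
noncomputable def grad {d : ℕ} (u : Fin (d + 1) → MacroField d) (m : Pt d) :
    Matrix (Fin (d + 1)) (Fin (d + 1)) ℝ := Matrix.of fun i j => pd j (u i) m

/-- The microscopic velocity gradient. -/
noncomputable def gradMic {d : ℕ} (U : Fin (d + 1) → LayerField d) (m z : Pt d) :
    Matrix (Fin (d + 1)) (Fin (d + 1)) ℝ := Matrix.of fun i j => pdMic j (U i) m z

/-- The velocity gradient with respect to `x`. -/
noncomputable def gradX {d : ℕ} (U : Fin (d + 1) → LayerField d) (m z : Pt d) :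
    Matrix (Fin (d + 1)) (Fin (d + 1)) ℝ := Matrix.of fun i j => pdX j (U i) m z

/-- The symmetric part of a gradient (rate of strain). -/
noncomputable def symPart {n : ℕ} (L : Matrix (Fin n) (Fin n) ℝ) : Matrix (Fin n) (Fin n) ℝ :=
  (1 / 2 : ℝ) • (L + L.transpose)

/-- The skew-symmetric part of a gradient (vorticity). -/
noncomputable def skewPart {n : ℕ} (L : Matrix (Fin n) (Fin n) ℝ) : Matrix (Fin n) (Fin n) ℝ :=
  (1 / 2 : ℝ) • (L - L.transpose)

/-- The bilinear map `g_a(L, T) = T W - W T - a (T D + D T)` of the Oldroyd derivative. -/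
noncomputable def oldroyd {n : ℕ} (a : ℝ) (L T : Matrix (Fin n) (Fin n) ℝ) :
    Matrix (Fin n) (Fin n) ℝ :=
  T * skewPart L - skewPart L * T - a • (T * symPart L + symPart L * T)

/-! ### The unknowns of the expansion and the elementary problems -/

/-- The unknowns of the asymptotic expansion: `(u_k, p_k, σ_k)` on the smooth domain, the boundary
layer correctors `(U_k, P_k, Σ_k)`, and the coefficients `a_k`, `b_k`, which do not depend on the
microscopic variable. Vectors and tensors are given by their components. -/
structure Expansion (d : ℕ) where
  u : ℕ → Fin (d + 1) → MacroField d
  p : ℕ → MacroField d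
  sig : ℕ → Fin (d + 1) → Fin (d + 1) → MacroField d
  U : ℕ → Fin (d + 1) → LayerField d
  P : ℕ → LayerField d
  Sig : ℕ → Fin (d + 1) → Fin (d + 1) → LayerField d
  a : ℕ → Fin (d + 1) → MacroField d
  b : ℕ → Fin (d + 1) → Fin (d + 1) → MacroField d

namespace Expansion

variable {d : ℕ}

/-- The tensor `σ_k` at a point. -/
def sigMat (S : Expansion d) (k : ℕ) (m : Pt d) : Matrix (Fin (d + 1)) (Fin (d + 1)) ℝ :=
  Matrix.of fun i j => S.sig k i j m

/-- The tensor `Σ_k` at a point. -/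
def SigMat (S : Expansion d) (k : ℕ) (m z : Pt d) : Matrix (Fin (d + 1)) (Fin (d + 1)) ℝ :=
  Matrix.of fun i j => S.Sig k i j m z

/-- The value at `m` of the velocity `u_k`. -/
def uAt (S : Expansion d) (k : ℕ) (m : Pt d) : Fin (d + 1) → ℝ := fun q => S.u k q m

/-- The value at `(m, z)` of the velocity `U_k`. -/
def UAt (S : Expansion d) (k : ℕ) (m z : Pt d) : Fin (d + 1) → ℝ := fun q => S.U k q m z

/-- The convective terms of order `k` in the momentum equation on the smooth domain: the sum of
`u_i · ∇u_j` over `i + j = k`. For `k ≥ 1` the terms `i = 0` and `i = k` form the linearized operator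
and the others the source `f_k`. -/
noncomputable def convection (S : Expansion d) (k : ℕ) (i : Fin (d + 1)) (m : Pt d) : ℝ :=
  ∑ j ∈ Finset.range (k + 1), adv (S.uAt j m) (S.u (k - j) i) m

/-- The convective terms of order `k` in the constitutive equation on the smooth domain: the sum of
`u_i · ∇σ_j + g_a(∇u_i, σ_j)` over `i + j = k`. -/
noncomputable def stressConvection (prm : FlowParams) (S : Expansion d) (k : ℕ)
    (i j : Fin (d + 1)) (m : Pt d) : ℝ :=
  ∑ q ∈ Finset.range (k + 1), (adv (S.uAt q m) (S.sig (k - q) i j) m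
    + oldroyd prm.slip (grad (S.u q) m) (S.sigMat (k - q) m) i j)

/-- `(u_k, p_k, σ_k)` is a smooth solution of the main problem of order `k` on the smooth domain,
with body force `f` (which acts at order `0` only). -/
structure IsMainSolution (prm : FlowParams) (f : Fin (d + 1) → MacroField d)
    (S : Expansion d) (k : ℕ) : Prop where
  smooth_u : ∀ i, ContDiff ℝ ∞ (S.u k i)
  smooth_p : ContDiff ℝ ∞ (S.p k)
  smooth_sig : ∀ i j, ContDiff ℝ ∞ (S.sig k i j)
  periodic_u : ∀ i, PeriodicPt (S.u k i)
  periodic_p : PeriodicPt (S.p k)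
  periodic_sig : ∀ i j, PeriodicPt (S.sig k i j)
  symm : ∀ i j, S.sig k i j = S.sig k j i
  momentum : ∀ m ∈ omegaZero d, ∀ i,
    prm.Re * S.convection k i m - (1 - prm.r) * lap (S.u k i) m + pd i (S.p k) m
      = ∑ j, pd j (S.sig k i j) m + (if k = 0 then f i m else 0) + S.a k i m
  incompressible : ∀ m ∈ omegaZero d, ∑ i, pd i (S.u k i) m = 0
  constitutive : ∀ m ∈ omegaZero d, ∀ i j,
    prm.We * S.stressConvection prm k i j m + S.sig k i j m - prm.D * lap (S.sig k i j) m
      = 2 * prm.r * symPart (grad (S.u k) m) i j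
  /- `u_k` is the opposite of the limit of the mean of `U_k` on the upper boundary -/
  top_u : ∀ (x : Fin d → ℝ) (i : Fin (d + 1)),
    Tendsto (fun Y : ℝ => torusInt fun X => S.U k i (x, 1) (X, Y)) atTop (𝓝 (-S.u k i (x, 1)))
  bottom_u : ∀ (x : Fin d → ℝ) (i : Fin (d + 1)), S.u k i (x, 0) = 0
  /- the outward unit normal is `(0, 1)` on the upper boundary and `(0, -1)` on the lower one -/
  top_sig : ∀ (x : Fin d → ℝ) (i j : Fin (d + 1)), pd (Fin.last d) (S.sig k i j) (x, 1) = 0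
  bottom_sig : ∀ (x : Fin d → ℝ) (i j : Fin (d + 1)),
    -pd (Fin.last d) (S.sig k i j) (x, 0) = S.b k i j (x, 0)

/-- The source `F_{n+2}` of the momentum equation in the boundary layer problem of order `n + 2`. -/
noncomputable def layerForce (prm : FlowParams) (S : Expansion d) (n : ℕ) (i : Fin (d + 1))
    (m z : Pt d) : ℝ :=
  ∑ j, pdMic j (S.Sig (n + 1) i j) m z
    + 2 * (1 - prm.r) * mixedLap (S.U (n + 1) i) m z
    + (1 - prm.r) * lapX (S.U n i) m z
    - pdX i (S.P (n + 1)) m z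
    + ∑ j, pdX j (S.Sig n i j) m z
    - prm.Re * ∑ q ∈ Finset.range (n + 1),
        (advMic (S.uAt q m + S.UAt q m z) (S.U (n + 1 - q) i) m z
          + advX (S.uAt q m + S.UAt q m z) (S.U (n - q) i) m z
          + adv (S.UAt q m z) (S.u (n - q) i) m)

/-- The source `G_{n+2}` of the stress equation in the boundary layer problem of order `n + 2`. -/
noncomputable def layerStress (prm : FlowParams) (S : Expansion d) (n : ℕ) (i j : Fin (d + 1))
    (m z : Pt d) : ℝ :=
  2 * prm.r * symPart (gradMic (S.U (n + 1)) m z) i j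
    + 2 * prm.r * symPart (gradX (S.U n) m z) i j
    - S.Sig n i j m z
    + 2 * prm.D * mixedLap (S.Sig (n + 1) i j) m z
    + prm.D * lapX (S.Sig n i j) m z
    - prm.We * ∑ q ∈ Finset.range (n + 1),
        (advMic (S.uAt q m) (S.Sig (n + 1 - q) i j) m z
          + advX (S.uAt q m) (S.Sig (n - q) i j) m z
          + adv (S.UAt q m z) (S.sig (n - q) i j) m
          + advMic (S.UAt q m z) (S.Sig (n + 1 - q) i j) m z
          + advX (S.UAt q m z) (S.Sig (n - q) i j) m z
          + oldroyd prm.slip (grad (S.u q) m) (S.SigMat (n - q) m z) i j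
          + oldroyd prm.slip (gradMic (S.U (q + 1)) m z + gradX (S.U q) m z)
              (S.sigMat (n - q) m + S.SigMat (n - q) m z) i j)

/-- The Dirichlet datum `D_k` at `(X, -H(X))`; the velocities are evaluated on `y = 0`. -/
noncomputable def layerDirichlet (H : (Fin d → ℝ) → ℝ) (S : Expansion d) (k : ℕ)
    (i : Fin (d + 1)) (m : Pt d) (X : Fin d → ℝ) : ℝ :=
  -∑ q ∈ Finset.Icc 1 k, (-1 : ℝ) ^ q / (q.factorial : ℝ) * H X ^ q
      * ((pd (Fin.last d))^[q] (S.u (k - q) i)) (m.1, 0)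

/-- `(∇H · ∇_x) g`, the gradient of `H` being taken at the fixed point `X`. -/
noncomputable def slopeDeriv (H : (Fin d → ℝ) → ℝ) (X : Fin d → ℝ) (g : Pt d → ℝ) (m : Pt d) : ℝ :=
  ∑ l : Fin d, fderiv ℝ H X (Pi.single l (1 : ℝ)) * pd l.castSucc g m

/-- The Neumann datum `N_k`, `k ≥ 1`, at `(X, -H(X))`. -/
noncomputable def layerNeumann (H : (Fin d → ℝ) → ℝ) (S : Expansion d) (k : ℕ)
    (i j : Fin (d + 1)) (m : Pt d) (X : Fin d → ℝ) : ℝ :=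
  slopeDeriv H X (S.sig (k - 1) i j) (m.1, 0)
    + slopeDeriv H X (fun m' => S.Sig (k - 1) i j m' (X, -H X)) m
    + ∑ q ∈ Finset.Icc 1 (k - 1), (-1 : ℝ) ^ q / (q.factorial : ℝ) * H X ^ q
        * ((pd (Fin.last d))^[q] (fun m' => slopeDeriv H X (S.sig (k - 1 - q) i j) m'
            + pd (Fin.last d) (S.sig (k - 1 - q) i j) m')) (m.1, 0)

/-- The class of strong solutions of a boundary layer problem, at the macroscopic point `m`:
`∇U ∈ H¹(Ω)`, `P ∈ H¹(Ω)` and `Σ ∈ H²(Ω)`. -/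
def InStrongClass (H : (Fin d → ℝ) → ℝ) (U : Fin (d + 1) → LayerField d) (P : LayerField d)
    (T : Fin (d + 1) → Fin (d + 1) → LayerField d) (m : Pt d) : Prop :=
  (∀ i q, InSobolev H 1 (pd q (U i m))) ∧ InSobolev H 1 (P m) ∧ ∀ i j, InSobolev H 2 (T i j m)

/-- `(U_k, P_k, Σ_k)`, `k ≥ 1`, is a strong solution of the boundary layer problem of order `k`, smooth
up to the boundary of `Ω` and smooth in the macroscopic variable (that is, the restriction of a smooth
function), which belongs to the class of strong solutions together with its first order derivatives in
`x`. The macroscopic point `m = (x, y)` is a parameter of the problem. At order one there is no source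
term. -/
structure IsLayerSolution (prm : FlowParams) (H : (Fin d → ℝ) → ℝ) (S : Expansion d) (k : ℕ) :
    Prop where
  smooth_U : ∀ i, ContDiff ℝ ∞ (fun w : Pt d × Pt d => S.U k i w.1 w.2)
  smooth_P : ContDiff ℝ ∞ (fun w : Pt d × Pt d => S.P k w.1 w.2)
  smooth_Sig : ∀ i j, ContDiff ℝ ∞ (fun w : Pt d × Pt d => S.Sig k i j w.1 w.2)
  periodic_U : ∀ i m, PeriodicPt (S.U k i m)
  periodic_P : ∀ m, PeriodicPt (S.P k m)
  periodic_Sig : ∀ i j m, PeriodicPt (S.Sig k i j m)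
  periodic_x_U : ∀ i z, PeriodicPt (fun m => S.U k i m z)
  periodic_x_P : ∀ z, PeriodicPt (fun m => S.P k m z)
  periodic_x_Sig : ∀ i j z, PeriodicPt (fun m => S.Sig k i j m z)
  symm : ∀ i j, S.Sig k i j = S.Sig k j i
  strong : ∀ m ∈ closedStrip d, InStrongClass H (S.U k) (S.P k) (S.Sig k) m
  strong_x : ∀ m ∈ closedStrip d, ∀ q,
    InStrongClass H (fun i => pdX q (S.U k i)) (pdX q (S.P k)) (fun i j => pdX q (S.Sig k i j)) m
  momentum : ∀ m ∈ closedStrip d, ∀ z ∈ layerDomain H, ∀ i,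
    -(1 - prm.r) * lap (S.U k i m) z + pdMic i (S.P k) m z
      = if k = 1 then 0 else S.layerForce prm (k - 2) i m z - S.a (k - 2) i m
  incompressible : ∀ m ∈ closedStrip d, ∀ z ∈ layerDomain H, ∑ i, pdMic i (S.U k i) m z = 0
  dirichlet : ∀ m ∈ closedStrip d, ∀ X i, S.U k i m (X, -H X) = S.layerDirichlet H k i m X
  stress : ∀ m ∈ closedStrip d, ∀ z ∈ layerDomain H, ∀ i j,
    -prm.D * lap (S.Sig k i j m) z = if k = 1 then 0 else S.layerStress prm (k - 2) i j m z
  /- `N = -(∇H, 1)` is the (non unit) outward normal -/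
  neumann : ∀ m ∈ closedStrip d, ∀ X i j,
    -slopeDeriv H X (S.Sig k i j m) (X, -H X) - pdMic (Fin.last d) (S.Sig k i j) m (X, -H X)
      = S.layerNeumann H k i j m X - S.b (k - 1) i j m

/-- The compatibility condition `a_n = lim_{Y → ∞} ∫_{𝕋^d} F_{n+2} dX`. -/
def IsCompatible (prm : FlowParams) (S : Expansion d) (n : ℕ) : Prop :=
  ∀ m ∈ closedStrip d, ∀ i,
    Tendsto (fun Y : ℝ => torusInt fun X => S.layerForce prm n i m (X, Y)) atTop (𝓝 (S.a n i m))

/-- The elementary problems needed at order `k` are solved: the main problems of order `0, …, k`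
and the boundary layer problems of order `1, …, k + 1`, with coefficients `a_0, …, a_k` given by the
compatibility condition. The expansion has no boundary layer corrector at order `0`. -/
structure IsElementarySystem (prm : FlowParams) (H : (Fin d → ℝ) → ℝ)
    (f : Fin (d + 1) → MacroField d) (S : Expansion d) (k : ℕ) : Prop where
  U_zero : ∀ i m z, S.U 0 i m z = 0
  Sig_zero : ∀ i j m z, S.Sig 0 i j m z = 0
  main : ∀ n ≤ k, S.IsMainSolution prm f n
  layer : ∀ n, 1 ≤ n → n ≤ k + 1 → S.IsLayerSolution prm H n
  compatible : ∀ n ≤ k, S.IsCompatible prm n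

end Expansion

/-- The integrand of the explicit formula for `a_k`. It is built on the velocities only:
`-Re u_0·∇_x U_k + (1-r) Δ_x U_k - Re ∑_{1≤i≤k-1} u_i·∇_x U_{k-i}
- Re ∑_{1≤i≤k} U_i·(∇_x U_{k-i} + ∇u_{k-i})`. -/
noncomputable def explicitIntegrand {d : ℕ} (prm : FlowParams)
    (u : ℕ → Fin (d + 1) → MacroField d) (U : ℕ → Fin (d + 1) → LayerField d) (k : ℕ)
    (i : Fin (d + 1)) (m z : Pt d) : ℝ :=
  -prm.Re * advX (fun q => u 0 q m) (U k i) m z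
    + (1 - prm.r) * lapX (U k i) m z
    - prm.Re * ∑ j ∈ Finset.Ico 1 k, advX (fun q => u j q m) (U (k - j) i) m z
    - prm.Re * ∑ j ∈ Finset.Icc 1 k,
        (advX (fun q => U j q m z) (U (k - j) i) m z + adv (fun q => U j q m z) (u (k - j) i) m)

/-! ### Partial derivatives -/

/-! The explicit integrand is what remains of F_{k+2} once the terms whose torus mean vanishes as Y
→ ∞ are removed (`Expansion.explicitIntegrand_eq`). Since a_k is by assumption the limit of the mean
of F_{k+2}, everything reduces to the decay of that remainder (`hasVanishingMean_layerRemainder`).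

Two mechanisms settle its linear terms. If g ∈ H¹(Ω), the squared L² norm of its slices and the
derivative of that norm are integrable in Y, so the slices, and with them their means, tend to zero
(`tendsto_torusInt`); this covers div Σ_{k+1}, ∇_x P_{k+1}, div_x Σ_k and u_q·∇U_n. The mixed
Laplacian involves only horizontal microscopic derivatives of periodic functions, which have mean
zero at every height (`torusInt_pd_castSucc`).

The delicate term is U_q·∇U_n, because only ∇U_q is known to lie in H¹(Ω) and U_q need not decay
(`HasVanishingMean.transport`). Each component of U_q is split into its slice mean and a
fluctuation. The fluctuation is controlled by the horizontal gradient through the Poincaré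
inequality. The mean of a horizontal component multiplies a horizontal derivative, of mean zero; the
mean of the vertical one is constant in Y by incompressibility and multiplies a quantity tending to
zero.

The removed terms are the only ones containing order k + 1 correctors or a nonzero contribution of
u_k, so the second claim follows by uniqueness of limits. -/

lemma dir_last {d : ℕ} : (dir (Fin.last d) : Pt d) = (0, 1) := by simp [dir]

lemma dir_castSucc {d : ℕ} (l : Fin d) : dir l.castSucc = (Pi.single l (1 : ℝ), (0 : ℝ)) := by
  simp [dir]

lemma contDiff_pd {d : ℕ} {g : Pt d → ℝ} (hg : ContDiff ℝ ∞ g) (i : Fin (d + 1)) :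
    ContDiff ℝ ∞ (pd i g) :=
  (hg.fderiv_right (m := ∞) le_rfl).clm_apply contDiff_const

lemma hasDerivAt_vertical {d : ℕ} {g : Pt d → ℝ} (hg : ContDiff ℝ ∞ g) (X : Fin d → ℝ) (Y : ℝ) :
    HasDerivAt (fun Y => g (X, Y)) (pd (Fin.last d) g (X, Y)) Y := by
  have h1 : HasFDerivAt g (fderiv ℝ g (X, Y)) (X, Y) :=
    (hg.differentiable (by simp)).differentiableAt.hasFDerivAt
  have h2 : HasDerivAt (fun Y : ℝ => (X, Y)) ((0 : Fin d → ℝ), (1 : ℝ)) Y :=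
    (hasDerivAt_const Y X).prodMk (hasDerivAt_id Y)
  have h3 := h1.comp_hasDerivAt Y h2
  rw [pd, dir_last]
  exact h3

lemma fderiv_horizontal {d : ℕ} {g : Pt d → ℝ} (hg : ContDiff ℝ ∞ g) (X : Fin d → ℝ) (Y : ℝ)
    (l : Fin d) :
    fderiv ℝ (fun X => g (X, Y)) X (Pi.single l 1) = pd l.castSucc g (X, Y) := by
  have h1 : HasFDerivAt g (fderiv ℝ g (X, Y)) (X, Y) :=
    (hg.differentiable (by simp)).differentiableAt.hasFDerivAt
  have h2 := HasFDerivAt.comp (f := fun X : Fin d → ℝ => (X, Y)) X h1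
    (hasFDerivAt_prodMk_left X Y)
  rw [pd, dir_castSucc]
  have h3 := h2.fderiv
  simp only [Function.comp_def] at h3
  rw [h3]
  simp

/-! ### Integration over the torus -/

section torus

variable {d : ℕ}

lemma integrableOn_cell {g : (Fin d → ℝ) → ℝ} (hg : Continuous g) :
    IntegrableOn g (Set.Icc 0 1) :=
  hg.continuousOn.integrableOn_compact isCompact_Icc

lemma torusInt_add {f g : (Fin d → ℝ) → ℝ} (hf : Continuous f) (hg : Continuous g) :
    torusInt (fun X => f X + g X) = torusInt f + torusInt g :=
  integral_add (integrableOn_cell hf) (integrableOn_cell hg)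

lemma torusInt_sub {f g : (Fin d → ℝ) → ℝ} (hf : Continuous f) (hg : Continuous g) :
    torusInt (fun X => f X - g X) = torusInt f - torusInt g :=
  integral_sub (integrableOn_cell hf) (integrableOn_cell hg)

lemma torusInt_const_mul (c : ℝ) (f : (Fin d → ℝ) → ℝ) :
    torusInt (fun X => c * f X) = c * torusInt f :=
  integral_const_mul c f

lemma torusInt_sum {ι : Type*} (s : Finset ι) {f : ι → (Fin d → ℝ) → ℝ}
    (hf : ∀ i ∈ s, Continuous (f i)) :
    torusInt (fun X => ∑ i ∈ s, f i X) = ∑ i ∈ s, torusInt (f i) :=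
  integral_finsetSum s fun i hi => integrableOn_cell (hf i hi)

lemma torusInt_const (c : ℝ) : torusInt (fun _ : Fin d → ℝ => c) = c := by
  simp [torusInt, Measure.real, Real.volume_Icc_pi]

lemma torusInt_mono {f g : (Fin d → ℝ) → ℝ} (hf : Continuous f) (hg : Continuous g)
    (h : ∀ X ∈ Set.Icc (0 : Fin d → ℝ) 1, f X ≤ g X) : torusInt f ≤ torusInt g :=
  setIntegral_mono_on (integrableOn_cell hf) (integrableOn_cell hg) measurableSet_Icc h

lemma torusInt_nonneg {f : (Fin d → ℝ) → ℝ} (h : ∀ X, 0 ≤ f X) : 0 ≤ torusInt f :=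
  integral_nonneg h

/-- Jensen's inequality for the square. -/
lemma sq_torusInt_le {f : (Fin d → ℝ) → ℝ} (hf : Continuous f) :
    torusInt f ^ 2 ≤ torusInt fun X => f X ^ 2 := by
  have h : 0 ≤ torusInt fun X => (f X ^ 2 - 2 * torusInt f * f X) + torusInt f ^ 2 :=
    torusInt_nonneg fun X => by nlinarith [sq_nonneg (f X - torusInt f)]
  rw [torusInt_add (by fun_prop) (by fun_prop), torusInt_sub (by fun_prop) (by fun_prop),
    torusInt_const_mul, torusInt_const] at h
  nlinarith

lemma abs_torusInt_mul_le {f g : (Fin d → ℝ) → ℝ} (hf : Continuous f) (hg : Continuous g) :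
    |torusInt fun X => f X * g X| ≤
      (torusInt fun X => f X ^ 2) + torusInt fun X => g X ^ 2 := by
  rw [← torusInt_add (by fun_prop) (by fun_prop), abs_le]
  constructor
  · have := torusInt_mono (f := fun X => (-1) * (f X ^ 2 + g X ^ 2)) (g := fun X => f X * g X)
      (by fun_prop) (by fun_prop) fun X _ => by
        nlinarith [sq_nonneg (f X + g X), sq_nonneg (f X), sq_nonneg (g X)]
    rw [torusInt_const_mul] at this
    linarith
  · exact torusInt_mono (by fun_prop) (by fun_prop) fun X _ => by
      nlinarith [sq_nonneg (f X - g X), sq_nonneg (f X), sq_nonneg (g X)]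

lemma continuous_slice {g : Pt d → ℝ} (hg : ContDiff ℝ ∞ g) (Y : ℝ) :
    Continuous fun X => g (X, Y) :=
  hg.continuous.comp (by fun_prop)

lemma hasDerivAt_torusInt {g : Pt d → ℝ} (hg : ContDiff ℝ ∞ g) (Y : ℝ) :
    HasDerivAt (fun Y => torusInt fun X => g (X, Y))
      (torusInt fun X => pd (Fin.last d) g (X, Y)) Y := by
  have hK : IsCompact (Set.Icc (0 : Fin d → ℝ) 1 ×ˢ Set.Icc (Y - 1) (Y + 1)) :=
    isCompact_Icc.prod isCompact_Icc
  obtain ⟨C, hC⟩ := hK.exists_bound_of_continuousOn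
    (contDiff_pd hg (Fin.last d)).continuous.continuousOn
  refine (hasDerivAt_integral_of_dominated_loc_of_deriv_le (μ := volume.restrict (Set.Icc 0 1))
    (s := Set.Icc (Y - 1) (Y + 1)) (F := fun Y X => g (X, Y))
    (F' := fun Y X => pd (Fin.last d) g (X, Y)) (bound := fun _ => C)
    (Icc_mem_nhds (by linarith) (by linarith)) ?_ ?_ ?_ ?_ ?_ ?_).2
  · exact Eventually.of_forall fun y => (continuous_slice hg y).aestronglyMeasurable
  · exact integrableOn_cell (continuous_slice hg Y)
  · exact (continuous_slice (contDiff_pd hg _) Y).aestronglyMeasurable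
  · exact (ae_restrict_iff' measurableSet_Icc).2
      (Eventually.of_forall fun X hX y hy => hC (X, y) ⟨hX, hy⟩)
  · exact integrableOn_cell continuous_const
  · exact Eventually.of_forall fun X y _ => hasDerivAt_vertical hg X y

/-- The horizontal derivatives of a periodic function have zero mean. -/
lemma torusInt_pd_castSucc {g : Pt d → ℝ} (hg : ContDiff ℝ ∞ g) (hp : PeriodicPt g)
    (l : Fin d) (Y : ℝ) : (torusInt fun X => pd l.castSucc g (X, Y)) = 0 := by
  obtain _ | n := d
  · exact l.elim0
  have hs : ContDiff ℝ ∞ fun X => g (X, Y) := hg.comp (contDiff_id.prodMk contDiff_const)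
  -- Divergence theorem on the unit cell for the vector field whose only nonzero component is the
  -- `l`-th, equal to `g`: only the two faces orthogonal to `l` contribute.
  have key := integral_divergence_of_hasFDerivAt_off_countable' (0 : Fin (n + 1) → ℝ) 1
    zero_le_one (fun i X => if i = l then g (X, Y) else 0)
    (fun i X => if i = l then fderiv ℝ (fun X => g (X, Y)) X else 0) ∅ Set.countable_empty
    (fun i => by split_ifs <;> [exact hs.continuous.continuousOn; exact continuousOn_const])
    (fun X _ i => by
      split_ifs
      · exact (hs.differentiable (by simp)).differentiableAt.hasFDerivAt
      · exact hasFDerivAt_const _ _)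
    (by
      refine integrableOn_cell ?_
      have : ∀ i : Fin (n + 1), Continuous fun X =>
          (if i = l then fderiv ℝ (fun X => g (X, Y)) X else 0) (Pi.single i 1) := fun i => by
        split_ifs with h
        · exact (hs.continuous_fderiv (by simp)).clm_apply continuous_const
        · exact continuous_const
      fun_prop)
  have h1 : ∀ X, (∑ i : Fin (n + 1),
      (if i = l then fderiv ℝ (fun X => g (X, Y)) X else 0) (Pi.single i 1))
      = pd l.castSucc g (X, Y) := fun X => by
    rw [Finset.sum_eq_single l (fun i _ hi => by simp [hi]) (by simp), if_pos rfl,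
      fderiv_horizontal hg]
  simp only [h1] at key
  rw [torusInt, key, Finset.sum_eq_single l (fun i _ hi => by simp [hi]) (by simp), sub_eq_zero]
  refine integral_congr_ae (Eventually.of_forall fun X => ?_)
  -- Periodicity by one unit along `l` identifies the face X_l = 0 with the face X_l = 1, so the two
  -- flux terms cancel.
  have h2 := hp (Pi.single l 1) (l.insertNth 0 X, Y)
  simp only [Pi.zero_apply, Pi.one_apply, if_true]
  rw [← h2]
  congr 2
  ext j
  refine Fin.succAboveCases l ?_ (fun j => ?_) j <;> simp

end torus

/-! ### Decay of means -/

section decay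

variable {d : ℕ} {H : (Fin d → ℝ) → ℝ}

/-- The square of the `L²` norm of a slice. -/
noncomputable def sliceSq (g : Pt d → ℝ) (Y : ℝ) : ℝ := torusInt fun X => g (X, Y) ^ 2

lemma sliceSq_nonneg (g : Pt d → ℝ) (Y : ℝ) : 0 ≤ sliceSq g Y :=
  torusInt_nonneg fun _ => sq_nonneg _

lemma pd_sq {g : Pt d → ℝ} (hg : ContDiff ℝ ∞ g) (i : Fin (d + 1)) :
    pd i (fun z => g z ^ 2) = fun z => 2 * (g z * pd i g z) := by
  ext z
  have h := ((hg.differentiable (by simp)).differentiableAt (x := z)).hasFDerivAt.pow 2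
  have h' : fderiv ℝ (fun z => g z ^ 2) z = _ := h.fderiv
  simp only [pd, h']
  simp
  ring

lemma hasDerivAt_sliceSq {g : Pt d → ℝ} (hg : ContDiff ℝ ∞ g) (Y : ℝ) :
    HasDerivAt (sliceSq g) (2 * torusInt fun X => g (X, Y) * pd (Fin.last d) g (X, Y)) Y := by
  have h := hasDerivAt_torusInt (hg.pow 2) Y
  simp only [pd_sq hg, torusInt_const_mul] at h
  exact h

/-- Positivity of H keeps the half-cylinder Y > 0 inside Ω, so the behaviour as Y → ∞ can be studied
on a product set, away from the rough boundary. -/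
lemma cell_prod_subset (hH : IsRoughness H) :
    Set.Icc (0 : Fin d → ℝ) 1 ×ˢ Set.Ioi (0 : ℝ) ⊆ layerCell H := fun _ hz =>
  ⟨hz.1, lt_trans (neg_lt_zero.2 (hH.pos _)) hz.2⟩

lemma integrable_mul_cell (hH : IsRoughness H) {f g : Pt d → ℝ}
    (hf : MemLp f 2 (volume.restrict (layerCell H)))
    (hg : MemLp g 2 (volume.restrict (layerCell H))) :
    IntegrableOn (fun Y => torusInt fun X => f (X, Y) * g (X, Y)) (Set.Ioi 0) := by
  have h1 : IntegrableOn (fun z => f z * g z) (Set.Icc (0 : Fin d → ℝ) 1 ×ˢ Set.Ioi (0 : ℝ)) :=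
    IntegrableOn.mono_set (hf.integrable_mul hg) (cell_prod_subset hH)
  rw [IntegrableOn, Measure.volume_eq_prod, ← Measure.prod_restrict] at h1
  exact h1.integral_prod_right

/-- Both the slice norm squared and its Y-derivative 2∫ g ∂_Y g are integrable on (0, ∞), as
integrals of products of L² functions. An integrable function with integrable derivative tends to
zero. -/
lemma tendsto_sliceSq (hH : IsRoughness H) {g : Pt d → ℝ} (hg : ContDiff ℝ ∞ g)
    (hs : InSobolev H 1 g) : Tendsto (sliceSq g) atTop (𝓝 0) := by
  refine tendsto_zero_of_hasDerivAt_of_integrableOn_Ioi (a := 0)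
    (fun Y _ => hasDerivAt_sliceSq hg Y) ?_ ?_
  · exact (integrable_mul_cell hH hs.1 (hs.2 (Fin.last d))).const_mul 2
  · have := integrable_mul_cell hH hs.1 hs.1
    simp only [← sq] at this
    exact this

lemma tendsto_torusInt (hH : IsRoughness H) {g : Pt d → ℝ} (hg : ContDiff ℝ ∞ g)
    (hs : InSobolev H 1 g) : Tendsto (fun Y => torusInt fun X => g (X, Y)) atTop (𝓝 0) := by
  have h : Tendsto (fun Y => (torusInt fun X => g (X, Y)) ^ 2) atTop (𝓝 0) :=
    squeeze_zero (fun _ => sq_nonneg _) (fun Y => sq_torusInt_le (continuous_slice hg Y))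
      (tendsto_sliceSq hH hg hs)
  have h2 := (Real.continuous_sqrt.tendsto 0).comp h
  simp only [Function.comp_def, Real.sqrt_sq_eq_abs, Real.sqrt_zero] at h2
  exact (tendsto_zero_iff_abs_tendsto_zero _).2 h2

/-- The mean of any first derivative tends to zero. -/
lemma tendsto_torusInt_pd (hH : IsRoughness H) {g : Pt d → ℝ} (hg : ContDiff ℝ ∞ g)
    (hs : ∀ q, InSobolev H 1 (pd q g)) (q : Fin (d + 1)) :
    Tendsto (fun Y => torusInt fun X => pd q g (X, Y)) atTop (𝓝 0) :=
  tendsto_torusInt hH (contDiff_pd hg q) (hs q)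

end decay

/-! ### The Poincaré inequality on the unit cell -/

section poincare

lemma sq_sub_le_integral_sq_deriv {h h' : ℝ → ℝ} (hd : ∀ x, HasDerivAt h (h' x) x)
    (hc : Continuous h') {s t : ℝ} (hs : s ∈ Set.Icc (0 : ℝ) 1) (ht : t ∈ Set.Icc (0 : ℝ) 1) :
    (h t - h s) ^ 2 ≤ ∫ x in (0 : ℝ)..1, h' x ^ 2 := by
  have hi : ∀ {f : ℝ → ℝ}, Continuous f → ∀ a b, IntervalIntegrable f volume a b :=
    fun hf a b => hf.intervalIntegrable a b
  have h1 : |h t - h s| ≤ ∫ x in (0 : ℝ)..1, |h' x| := by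
    rw [← intervalIntegral.integral_eq_sub_of_hasDerivAt (fun x _ => hd x) (hi hc s t)]
    rw [← Real.norm_eq_abs]
    refine (intervalIntegral.norm_integral_le_integral_norm_uIoc
      (f := h') (a := s) (b := t)).trans ?_
    rw [intervalIntegral.integral_of_le zero_le_one]
    refine setIntegral_mono_set ((hi hc.abs 0 1).1) (Eventually.of_forall fun _ => abs_nonneg _)
      (LE.le.eventuallyLE ?_)
    intro x hx
    rcases le_total s t with hst | hst
    · rw [Set.uIoc_of_le hst] at hx
      exact ⟨hs.1.trans_lt hx.1, hx.2.trans ht.2⟩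
    · rw [Set.uIoc_of_ge hst] at hx
      exact ⟨ht.1.trans_lt hx.1, hx.2.trans hs.2⟩
  -- With `c` the mean of |h'|, expanding 0 ≤ ∫ (|h'| - c)² gives c² ≤ ∫ h'².
  set c := ∫ x in (0 : ℝ)..1, |h' x|
  have h2 : 0 ≤ ∫ x in (0 : ℝ)..1, (h' x ^ 2 - 2 * c * |h' x| + c ^ 2) :=
    intervalIntegral.integral_nonneg zero_le_one fun x _ => by
      nlinarith [sq_nonneg (|h' x| - c), sq_abs (h' x)]
  rw [intervalIntegral.integral_add (hi (by fun_prop) _ _) (hi (by fun_prop) _ _),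
    intervalIntegral.integral_sub (hi (by fun_prop) _ _) (hi (by fun_prop) _ _),
    intervalIntegral.integral_const_mul] at h2
  simp only [intervalIntegral.integral_const, sub_zero, smul_eq_mul, one_mul] at h2
  have h3 : (h t - h s) ^ 2 ≤ c ^ 2 := by
    rw [← sq_abs (h t - h s)]
    gcongr
  change 0 ≤ _ - 2 * c * c + c ^ 2 at h2
  nlinarith

variable {d : ℕ}

/-- The deviation g(X) - ∫ g is the average over X' of g(X) - g(X'), so Jensen's inequality bounds
its square by the average of the squared differences. Keeping A and B as functions of one point each
lets the double integral separate. -/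
lemma torusInt_sq_sub_mean_le {g A B : (Fin d → ℝ) → ℝ} (hg : Continuous g) (hA : Continuous A)
    (hB : Continuous B)
    (h : ∀ X ∈ Set.Icc (0 : Fin d → ℝ) 1, ∀ X' ∈ Set.Icc (0 : Fin d → ℝ) 1,
      (g X - g X') ^ 2 ≤ A X + B X') :
    (torusInt fun X => (g X - torusInt g) ^ 2) ≤ torusInt A + torusInt B := by
  have h1 : ∀ X ∈ Set.Icc (0 : Fin d → ℝ) 1, (g X - torusInt g) ^ 2 ≤ A X + torusInt B := by
    intro X hX
    have h2 := sq_torusInt_le (f := fun X' => g X - g X') (by fun_prop)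
    rw [torusInt_sub (by fun_prop) hg, torusInt_const] at h2
    refine h2.trans ((torusInt_mono (by fun_prop) (by fun_prop) fun X' hX' => h X hX X' hX').trans
      (le_of_eq ?_))
    rw [torusInt_add (by fun_prop) hB, torusInt_const]
  refine (torusInt_mono (by fun_prop) (by fun_prop) h1).trans (le_of_eq ?_)
  rw [torusInt_add hA (by fun_prop), torusInt_const]

lemma torusInt_one (g : (Fin 1 → ℝ) → ℝ) : torusInt g = ∫ x in (0 : ℝ)..1, g (fun _ => x) := by
  rw [intervalIntegral.integral_of_le zero_le_one, ← integral_Icc_eq_integral_Ioc]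
  refine (((volume_preserving_funUnique (Fin 1) ℝ).symm _).setIntegral_preimage_emb
    (MeasurableEquiv.measurableEmbedding _) g (Set.Icc 0 1)).symm.trans ?_
  congr 1
  congr 1
  ext x
  simp [Pi.le_def]

lemma torusInt_two {g : (Fin 2 → ℝ) → ℝ} (hg : Continuous g) :
    torusInt g = ∫ x in (0 : ℝ)..1, ∫ y in (0 : ℝ)..1, g ![x, y] := by
  have h1 : torusInt g = ∫ p in Set.Icc (0 : ℝ) 1 ×ˢ Set.Icc (0 : ℝ) 1, g ![p.1, p.2] := by
    rw [torusInt, ← ((volume_preserving_finTwoArrow ℝ).symm _).setIntegral_preimage_emb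
      (MeasurableEquiv.measurableEmbedding _)]
    congr 1
    congr 1
    ext x
    simp [Pi.le_def, Prod.le_def]
  have hc : Continuous fun p : ℝ × ℝ => g ![p.1, p.2] := hg.comp (by fun_prop)
  rw [h1, Measure.volume_eq_prod, setIntegral_prod _
    (hc.continuousOn.integrableOn_compact (isCompact_Icc.prod isCompact_Icc))]
  simp only [intervalIntegral.integral_of_le zero_le_one, integral_Icc_eq_integral_Ioc]

lemma torusInt_two_swap {g : (Fin 2 → ℝ) → ℝ} (hg : Continuous g) :
    torusInt g = ∫ y in (0 : ℝ)..1, ∫ x in (0 : ℝ)..1, g ![x, y] := by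
  have hc : Continuous fun p : ℝ × ℝ => g ![p.1, p.2] := hg.comp (by fun_prop)
  rw [torusInt_two hg]
  simp only [intervalIntegral.integral_of_le zero_le_one]
  refine integral_integral_swap (f := fun x y => g ![x, y]) ?_
  rw [Measure.prod_restrict]
  exact (hc.continuousOn.integrableOn_compact (isCompact_Icc.prod isCompact_Icc)).mono_set
    (Set.prod_mono Set.Ioc_subset_Icc_self Set.Ioc_subset_Icc_self)

/-- The partial derivative along a coordinate line. -/
lemma hasDerivAt_comp_update {g : Pt d → ℝ} (hg : ContDiff ℝ ∞ g) (X : Fin d → ℝ) (l : Fin d)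
    (Y t : ℝ) : HasDerivAt (fun t => g (Function.update X l t, Y))
      (pd l.castSucc g (Function.update X l t, Y)) t := by
  have h1 : HasFDerivAt g (fderiv ℝ g (Function.update X l t, Y)) (Function.update X l t, Y) :=
    (hg.differentiable (by simp)).differentiableAt.hasFDerivAt
  have h2 : HasDerivAt (fun t : ℝ => (Function.update X l t, Y)) (Pi.single l (1 : ℝ), (0 : ℝ)) t :=
    (hasDerivAt_update X l t).prodMk (hasDerivAt_const t Y)
  rw [pd, dir_castSucc]
  exact h1.comp_hasDerivAt t h2

lemma poincare_one {g : Pt 1 → ℝ} (hg : ContDiff ℝ ∞ g) (Y : ℝ) :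
    (torusInt fun X => (g (X, Y) - torusInt fun X => g (X, Y)) ^ 2) ≤
      2 * ∑ l, sliceSq (pd (Fin.castSucc l) g) Y := by
  have hu : ∀ (X : Fin 1 → ℝ) (t : ℝ), Function.update X 0 t = fun _ => t := fun X t => by
    ext j; fin_cases j; simp
  -- In dimension one any two points lie on the same coordinate line, so A is a constant and B = 0;
  -- the factor 2 of the statement is only needed in dimension two.
  have h := torusInt_sq_sub_mean_le (continuous_slice hg Y)
    (A := fun _ => sliceSq (pd (Fin.castSucc 0) g) Y) (B := fun _ => 0)
    continuous_const continuous_const (fun X hX X' hX' => by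
      have h1 := sq_sub_le_integral_sq_deriv (fun t => hasDerivAt_comp_update hg X 0 Y t)
        ((contDiff_pd hg _).continuous.comp (by fun_prop)) ⟨hX'.1 0, hX'.2 0⟩ ⟨hX.1 0, hX.2 0⟩
      simp only [hu] at h1
      rw [add_zero, sliceSq, torusInt_one]
      convert h1 using 5 <;> (ext j; fin_cases j; rfl))
  simp only [torusInt_const, add_zero] at h
  simp only [Fin.sum_univ_one]
  linarith [sliceSq_nonneg (pd (Fin.castSucc 0) g) Y]

lemma poincare_two {g : Pt 2 → ℝ} (hg : ContDiff ℝ ∞ g) (Y : ℝ) :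
    (torusInt fun X => (g (X, Y) - torusInt fun X => g (X, Y)) ^ 2) ≤
      2 * ∑ l, sliceSq (pd (Fin.castSucc l) g) Y := by
  have hu0 : ∀ (x y t : ℝ), Function.update ![x, y] 0 t = ![t, y] := fun x y t => by
    ext j; fin_cases j <;> simp
  have hu1 : ∀ (x y t : ℝ), Function.update ![x, y] 1 t = ![x, t] := fun x y t => by
    ext j; fin_cases j <;> simp
  have hc : ∀ l, Continuous fun X => pd (Fin.castSucc l) g (X, Y) ^ 2 := fun l =>
    (continuous_slice (contDiff_pd hg _) Y).pow 2
  have hA : Continuous fun y => ∫ ξ in (0 : ℝ)..1, pd (Fin.castSucc 0) g (![ξ, y], Y) ^ 2 :=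
    intervalIntegral.continuous_parametric_intervalIntegral_of_continuous'
      (f := fun s t => pd (Fin.castSucc 0) g (![t, s], Y) ^ 2)
      ((hc 0).comp (g := fun X => pd (Fin.castSucc 0) g (X, Y) ^ 2)
        (f := fun p : ℝ × ℝ => ![p.2, p.1]) (by fun_prop)) 0 1
  have hB : Continuous fun x => ∫ η in (0 : ℝ)..1, pd (Fin.castSucc 1) g (![x, η], Y) ^ 2 :=
    intervalIntegral.continuous_parametric_intervalIntegral_of_continuous'
      (f := fun s t => pd (Fin.castSucc 1) g (![s, t], Y) ^ 2)
      ((hc 1).comp (g := fun X => pd (Fin.castSucc 1) g (X, Y) ^ 2)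
        (f := fun p : ℝ × ℝ => ![p.1, p.2]) (by fun_prop)) 0 1
  have hA' : Continuous fun X : Fin 2 → ℝ =>
      2 * ∫ ξ in (0 : ℝ)..1, pd (Fin.castSucc 0) g (![ξ, X 1], Y) ^ 2 :=
    (hA.comp (continuous_apply 1)).const_mul 2
  have hB' : Continuous fun X : Fin 2 → ℝ =>
      2 * ∫ η in (0 : ℝ)..1, pd (Fin.castSucc 1) g (![X 0, η], Y) ^ 2 :=
    (hB.comp (continuous_apply 0)).const_mul 2
  -- The points X' and X are joined through the corner (X'_0, X_1). The first coordinate varies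
  -- along the line at height X_1, giving a bound that depends on X only; the second varies along
  -- the line through X'_0, giving a bound that depends on X' only. The factor 2 comes from (a + b)²
  -- ≤ 2a² + 2b².
  have h := torusInt_sq_sub_mean_le (continuous_slice hg Y) hA' hB' (fun X hX X' hX' => by
    have h0 := sq_sub_le_integral_sq_deriv (fun t => hasDerivAt_comp_update hg ![X 0, X 1] 0 Y t)
      ((contDiff_pd hg _).continuous.comp (by fun_prop)) ⟨hX'.1 0, hX'.2 0⟩ ⟨hX.1 0, hX.2 0⟩
    have h1 := sq_sub_le_integral_sq_deriv (fun t => hasDerivAt_comp_update hg ![X' 0, X' 1] 1 Y t)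
      ((contDiff_pd hg _).continuous.comp (by fun_prop)) ⟨hX'.1 1, hX'.2 1⟩ ⟨hX.1 1, hX.2 1⟩
    simp only [hu0, hu1] at h0 h1
    have e : ∀ Z : Fin 2 → ℝ, ![Z 0, Z 1] = Z := fun Z => by ext j; fin_cases j <;> rfl
    rw [e] at h0 h1
    nlinarith [sq_nonneg ((g (X, Y) - g (![X' 0, X 1], Y)) - (g (![X' 0, X 1], Y) - g (X', Y)))])
  -- A is already integrated in the first coordinate and B in the second, so each calls for its own
  -- order of integration.
  have hA2 := torusInt_two_swap (hA.comp (continuous_apply (A := fun _ : Fin 2 => ℝ) 1))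
  have hB2 := torusInt_two (hB.comp (continuous_apply (A := fun _ : Fin 2 => ℝ) 0))
  simp only [Function.comp_def] at hA2 hB2
  rw [torusInt_const_mul, torusInt_const_mul, hA2, hB2] at h
  simp only [Matrix.cons_val_zero, Matrix.cons_val_one, intervalIntegral.integral_const, sub_zero,
    one_smul] at h
  rw [Fin.sum_univ_two, sliceSq, sliceSq, torusInt_two_swap (hc 0), torusInt_two (hc 1)]
  linarith

/-- The Poincaré inequality on the slices. -/
lemma torusInt_sq_sub_mean_le_sliceSq_pd (hd : d = 1 ∨ d = 2) {g : Pt d → ℝ}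
    (hg : ContDiff ℝ ∞ g) (Y : ℝ) :
    (torusInt fun X => (g (X, Y) - torusInt fun X => g (X, Y)) ^ 2) ≤
      2 * ∑ l, sliceSq (pd (Fin.castSucc l) g) Y := by
  rcases hd with rfl | rfl
  exacts [poincare_one hg Y, poincare_two hg Y]

end poincare

/-! ### Functions whose means tend to zero -/

/-- `g` is smooth and its mean over the torus at height `Y` tends to zero as `Y → ∞`. -/
def HasVanishingMean {d : ℕ} (g : Pt d → ℝ) : Prop :=
  ContDiff ℝ ∞ g ∧ Tendsto (fun Y => torusInt fun X => g (X, Y)) atTop (𝓝 0)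

namespace HasVanishingMean

variable {d : ℕ} {f g : Pt d → ℝ}

lemma zero : HasVanishingMean (fun _ : Pt d => (0 : ℝ)) :=
  ⟨contDiff_const, by simp [torusInt_const]⟩

lemma add (hf : HasVanishingMean f) (hg : HasVanishingMean g) :
    HasVanishingMean fun z => f z + g z := by
  refine ⟨hf.1.add hg.1, ?_⟩
  simp only [torusInt_add (continuous_slice hf.1 _) (continuous_slice hg.1 _)]
  simpa using hf.2.add hg.2

lemma const_mul (c : ℝ) (hf : HasVanishingMean f) : HasVanishingMean fun z => c * f z := by
  refine ⟨contDiff_const.mul hf.1, ?_⟩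
  simp only [torusInt_const_mul]
  simpa using hf.2.const_mul c

lemma sub (hf : HasVanishingMean f) (hg : HasVanishingMean g) :
    HasVanishingMean fun z => f z - g z := by
  simpa [sub_eq_add_neg] using hf.add (hg.const_mul (-1))

lemma sum {ι : Type*} (s : Finset ι) {f : ι → Pt d → ℝ}
    (hf : ∀ i ∈ s, HasVanishingMean (f i)) : HasVanishingMean fun z => ∑ i ∈ s, f i z := by
  refine ⟨ContDiff.sum fun i hi => (hf i hi).1, ?_⟩
  simp only [torusInt_sum s fun i hi => continuous_slice (hf i hi).1 _]
  simpa using tendsto_finsetSum s fun i hi => (hf i hi).2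

lemma pd_castSucc (hg : ContDiff ℝ ∞ g) (hp : PeriodicPt g) (l : Fin d) :
    HasVanishingMean (pd l.castSucc g) :=
  ⟨contDiff_pd hg _, by simp [torusInt_pd_castSucc hg hp]⟩

end HasVanishingMean

/-! ### Transport by a solenoidal field that need not decay -/

section transport

variable {d : ℕ} {H : (Fin d → ℝ) → ℝ}

/-- The vertical component of a solenoidal field has a constant mean. -/
lemma torusInt_last_eq (hH : IsRoughness H) {U : Fin (d + 1) → Pt d → ℝ}
    (hU : ∀ i, ContDiff ℝ ∞ (U i)) (hp : ∀ i, PeriodicPt (U i))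
    (hdiv : ∀ z ∈ layerDomain H, ∑ i, pd i (U i) z = 0) {Y : ℝ} (hY : 0 < Y) :
    (torusInt fun X => U (Fin.last d) (X, Y)) = torusInt fun X => U (Fin.last d) (X, 1) := by
  have h0 : ∀ Y : ℝ, 0 < Y → (torusInt fun X => pd (Fin.last d) (U (Fin.last d)) (X, Y)) = 0 := by
    intro Y hY
    have h1 : ∀ X, pd (Fin.last d) (U (Fin.last d)) (X, Y)
        = (-1) * ∑ l : Fin d, pd l.castSucc (U l.castSucc) (X, Y) := fun X => by
      have := hdiv (X, Y) (lt_trans (neg_lt_zero.2 (hH.pos X)) hY)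
      rw [Fin.sum_univ_castSucc] at this
      linarith
    simp only [h1, torusInt_const_mul]
    rw [torusInt_sum _ fun l _ => continuous_slice (contDiff_pd (hU _) _) Y]
    simp [torusInt_pd_castSucc (hU _) (hp _)]
  refine isOpen_Ioi.is_const_of_deriv_eq_zero isPreconnected_Ioi
    (f := fun Y => torusInt fun X => U (Fin.last d) (X, Y))
    (fun y _ => (hasDerivAt_torusInt (hU _) y).differentiableAt.differentiableWithinAt)
    (fun y hy => ?_) hY (Set.mem_Ioi.2 one_pos)
  rw [(hasDerivAt_torusInt (hU _) y).deriv, h0 y hy]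
  rfl

/-- The mean of the transport term `U · ∇v` tends to zero. -/
lemma HasVanishingMean.transport (hd : d = 1 ∨ d = 2) (hH : IsRoughness H)
    {U : Fin (d + 1) → Pt d → ℝ} {v : Pt d → ℝ}
    (hU : ∀ i, ContDiff ℝ ∞ (U i)) (hp : ∀ i, PeriodicPt (U i))
    (hdiv : ∀ z ∈ layerDomain H, ∑ i, pd i (U i) z = 0)
    (hUs : ∀ i q, InSobolev H 1 (pd q (U i))) (hv : ContDiff ℝ ∞ v) (hvp : PeriodicPt v)
    (hvs : ∀ q, InSobolev H 1 (pd q v)) :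
    HasVanishingMean fun z => ∑ q, U q z * pd q v z := by
  refine HasVanishingMean.sum _ fun q _ => ⟨(hU q).mul (contDiff_pd hv q), ?_⟩
  -- `c` is the slice mean of U_q; only the fluctuation U_q - c is controlled by ∇U_q.
  set c : ℝ → ℝ := fun Y => torusInt fun X => U q (X, Y)
  have hsplit : ∀ Y, (torusInt fun X => U q (X, Y) * pd q v (X, Y))
      = (torusInt fun X => (U q (X, Y) - c Y) * pd q v (X, Y))
        + c Y * torusInt fun X => pd q v (X, Y) := fun Y => by
    have h1 := continuous_slice (hU q) Y
    have h2 := continuous_slice (contDiff_pd hv q) Y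
    rw [← torusInt_const_mul, ← torusInt_add (by fun_prop) (by fun_prop)]
    congr 1
    ext X
    ring
  simp only [hsplit]
  rw [← add_zero (0 : ℝ)]
  refine Tendsto.add ?_ ?_
  · refine squeeze_zero_norm (a := fun Y => 2 * ∑ l, sliceSq (pd (Fin.castSucc l) (U q)) Y
      + sliceSq (pd q v) Y) (fun Y => ?_) ?_
    · have h1 := continuous_slice (hU q) Y
      have h2 := continuous_slice (contDiff_pd hv q) Y
      rw [Real.norm_eq_abs]
      refine (abs_torusInt_mul_le (by fun_prop) h2).trans ?_
      gcongr
      · exact torusInt_sq_sub_mean_le_sliceSq_pd hd (hU q) Y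
      · exact le_rfl
    · have h := ((tendsto_finsetSum Finset.univ fun l (_ : l ∈ Finset.univ) =>
        tendsto_sliceSq hH (contDiff_pd (hU q) (Fin.castSucc l)) (hUs q _)).const_mul 2).add
        (tendsto_sliceSq hH (contDiff_pd hv q) (hvs q))
      simpa using h
  -- For a horizontal index no bound on `c` is needed, since the other factor is exactly zero. For
  -- the vertical index `c` is frozen at its value at height 1, an arbitrary reference height in Y >
  -- 0.
  · rcases Fin.eq_castSucc_or_eq_last q with ⟨l, rfl⟩ | rfl
    · simp [torusInt_pd_castSucc hv hvp]
    · have h := (tendsto_torusInt_pd hH hv hvs (Fin.last d)).const_mul (c 1)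
      rw [mul_zero] at h
      refine h.congr' ?_
      filter_upwards [eventually_gt_atTop 0] with Y hY
      simp only [c, torusInt_last_eq hH hU hp hdiv hY]

end transport

/-! ### Boundary layer fields -/

section layer

variable {d : ℕ}

/-- Joint smoothness in the macroscopic and the microscopic variables. -/
def JointlySmooth (V : LayerField d) : Prop := ContDiff ℝ ∞ fun w : Pt d × Pt d => V w.1 w.2

lemma jointlySmooth_zero : JointlySmooth (fun _ _ => 0 : LayerField d) := contDiff_const

namespace JointlySmooth

variable {V : LayerField d}

lemma slice (hV : JointlySmooth V) (m : Pt d) : ContDiff ℝ ∞ (V m) :=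
  ContDiff.comp (g := fun w : Pt d × Pt d => V w.1 w.2) (f := fun z => (m, z)) hV
    (contDiff_const.prodMk contDiff_id)

lemma pdMic_eq (hV : JointlySmooth V) (i : Fin (d + 1)) (m z : Pt d) :
    pdMic i V m z = fderiv ℝ (fun w : Pt d × Pt d => V w.1 w.2) (m, z) (0, dir i) := by
  have h1 : HasFDerivAt (fun w : Pt d × Pt d => V w.1 w.2) _ (m, z) :=
    (ContDiff.differentiable hV (by simp)).differentiableAt.hasFDerivAt
  have h2 := HasFDerivAt.comp (f := fun z : Pt d => (m, z)) z h1 (hasFDerivAt_prodMk_right m z)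
  have h3 : fderiv ℝ (V m) z = _ := h2.fderiv
  rw [pdMic, pd, h3]
  simp

lemma pdX_castSucc_eq (hV : JointlySmooth V) (l : Fin d) (m z : Pt d) :
    pdX l.castSucc V m z
      = fderiv ℝ (fun w : Pt d × Pt d => V w.1 w.2) (m, z) (dir l.castSucc, 0) := by
  have h1 : HasFDerivAt (fun w : Pt d × Pt d => V w.1 w.2) _ (m, z) :=
    (ContDiff.differentiable hV (by simp)).differentiableAt.hasFDerivAt
  have h2 := HasFDerivAt.comp (f := fun m : Pt d => (m, z)) m h1 (hasFDerivAt_prodMk_left m z)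
  have h3 : fderiv ℝ (fun m => V m z) m = _ := h2.fderiv
  rw [pdX, if_neg (Fin.castSucc_lt_last l).ne, pd, h3]
  simp

lemma pdMic (hV : JointlySmooth V) (i : Fin (d + 1)) : JointlySmooth (pdMic i V) := by
  rw [JointlySmooth]
  simp only [hV.pdMic_eq]
  exact (ContDiff.fderiv_right (m := ∞) hV le_rfl).clm_apply contDiff_const

lemma pdX (hV : JointlySmooth V) (i : Fin (d + 1)) : JointlySmooth (pdX i V) := by
  rcases Fin.eq_castSucc_or_eq_last i with ⟨l, rfl⟩ | rfl
  · rw [JointlySmooth]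
    simp only [hV.pdX_castSucc_eq]
    exact (ContDiff.fderiv_right (m := ∞) hV le_rfl).clm_apply contDiff_const
  · simpa [JointlySmooth, _root_.pdX] using contDiff_const

/-- Both sides are values of the second derivative of the joint map (m, z) ↦ V m z, which is
symmetric. This turns a macroscopic derivative of ∂_{X_l} V into a microscopic derivative of a
periodic field. -/
lemma pdX_pdMic_comm (hV : JointlySmooth V) (l : Fin d) (q : Fin (d + 1)) (m z : Pt d) :
    _root_.pdX l.castSucc (_root_.pdMic q V) m z = _root_.pdMic q (_root_.pdX l.castSucc V) m z := by
  have hs : IsSymmSndFDerivAt ℝ (fun w : Pt d × Pt d => V w.1 w.2) (m, z) :=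
    (ContDiff.contDiffAt hV).isSymmSndFDerivAt
      (by simpa using WithTop.coe_le_coe.2 (le_top : (2 : ℕ∞) ≤ ⊤))
  have h1 : DifferentiableAt ℝ (fderiv ℝ fun w : Pt d × Pt d => V w.1 w.2) (m, z) :=
    ((ContDiff.fderiv_right (m := ∞) hV le_rfl).differentiable (by simp)).differentiableAt
  rw [(hV.pdMic q).pdX_castSucc_eq, (hV.pdX l.castSucc).pdMic_eq]
  simp only [hV.pdMic_eq, hV.pdX_castSucc_eq]
  rw [fderiv_clm_apply h1 (differentiableAt_const _), fderiv_clm_apply h1 (differentiableAt_const _)]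
  simpa using hs _ _

lemma advMic (hV : JointlySmooth V) {v : Pt d → Fin (d + 1) → ℝ}
    (hv : ∀ q, ContDiff ℝ ∞ fun z => v z q) (m : Pt d) :
    ContDiff ℝ ∞ fun z => advMic (v z) V m z :=
  ContDiff.sum fun q _ => (hv q).mul ((hV.pdMic q).slice m)

lemma advX (hV : JointlySmooth V) {v : Pt d → Fin (d + 1) → ℝ}
    (hv : ∀ q, ContDiff ℝ ∞ fun z => v z q) (m : Pt d) :
    ContDiff ℝ ∞ fun z => advX (v z) V m z :=
  ContDiff.sum fun q _ => (hv q).mul ((hV.pdX q).slice m)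

lemma lapX (hV : JointlySmooth V) (m : Pt d) : ContDiff ℝ ∞ (lapX V m) :=
  ContDiff.sum fun q _ => ((hV.pdX q).pdX q).slice m

end JointlySmooth

lemma pdX_last (V : LayerField d) (m z : Pt d) : pdX (Fin.last d) V m z = 0 := if_pos rfl

lemma pdX_zero (i : Fin (d + 1)) : pdX i (fun _ _ => 0 : LayerField d) = fun _ _ => 0 := by
  ext m z
  simp [pdX, pd]

lemma periodicPt_pdX {V : LayerField d} (hV : ∀ m, PeriodicPt (V m)) (i : Fin (d + 1)) (m : Pt d) :
    PeriodicPt (pdX i V m) := fun n z => by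
  simp only [pdX, fun m' => hV m' n z]

/-- The mixed Laplacian of a periodic field has zero mean. -/
lemma HasVanishingMean.mixedLap {V : LayerField d} (hV : JointlySmooth V)
    (hp : ∀ m, PeriodicPt (V m)) (m : Pt d) : HasVanishingMean (mixedLap V m) := by
  refine HasVanishingMean.sum _ fun q _ => ?_
  rcases Fin.eq_castSucc_or_eq_last q with ⟨l, rfl⟩ | rfl
  · rw [show pdX l.castSucc (pdMic l.castSucc V) m = pd l.castSucc (pdX l.castSucc V m) from
      funext fun z => hV.pdX_pdMic_comm l l.castSucc m z]
    exact HasVanishingMean.pd_castSucc ((hV.pdX _).slice m) (periodicPt_pdX hp _ m) l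
  · rw [show pdX (Fin.last d) (pdMic (Fin.last d) V) m = fun _ => 0 from
      funext fun z => pdX_last _ m z]
    exact zero

end layer

/-! ### The explicit formula -/

namespace Expansion

variable {d : ℕ}

/-- The part of the source `F_{k+2}` that does not contribute to its mean as `Y → ∞`. -/
noncomputable def layerRemainder (prm : FlowParams) (S : Expansion d) (k : ℕ) (i : Fin (d + 1))
    (m z : Pt d) : ℝ :=
  ∑ j, pdMic j (S.Sig (k + 1) i j) m z
    + 2 * (1 - prm.r) * mixedLap (S.U (k + 1) i) m z
    - pdX i (S.P (k + 1)) m z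
    + ∑ j, pdX j (S.Sig k i j) m z
    - prm.Re * ∑ q ∈ Finset.range (k + 1),
        advMic (S.uAt q m + S.UAt q m z) (S.U (k + 1 - q) i) m z

lemma advX_add (v w : Fin (d + 1) → ℝ) (V : LayerField d) (m z : Pt d) :
    advX (v + w) V m z = advX v V m z + advX w V m z := by
  simp [advX, add_mul, Finset.sum_add_distrib]

lemma advX_of_eq_zero {V : LayerField d} (hV : V = fun _ _ => 0) (v : Fin (d + 1) → ℝ)
    (m z : Pt d) : advX v V m z = 0 := by
  simp [hV, advX, pdX_zero]

lemma explicitIntegrand_eq (prm : FlowParams) (S : Expansion d)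
    (hU : ∀ i m z, S.U 0 i m z = 0) (k : ℕ) (i : Fin (d + 1)) (m z : Pt d) :
    explicitIntegrand prm S.u S.U k i m z
      = S.layerForce prm k i m z - S.layerRemainder prm k i m z := by
  have hU0 : ∀ i, S.U 0 i = fun _ _ => 0 := fun i => funext₂ (hU i)
  have hu0 : S.UAt 0 m z = 0 := funext fun q => hU q m z
  have hadv : ∀ g : MacroField d, adv (0 : Fin (d + 1) → ℝ) g m = 0 := fun g => by simp [adv]
  have hadvX : ∀ V : LayerField d, advX (0 : Fin (d + 1) → ℝ) V m z = 0 := fun g => by simp [advX]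
  -- Since U_0 = 0, the index q = k drops out of u_q·∇_x U_{k-q}, and q = 0 drops out of the terms
  -- transported by U_q.
  have hsum : ∑ q ∈ Finset.range (k + 1),
        (advX (S.uAt q m + S.UAt q m z) (S.U (k - q) i) m z
          + adv (S.UAt q m z) (S.u (k - q) i) m)
      = advX (S.uAt 0 m) (S.U k i) m z
        + ∑ j ∈ Finset.Ico 1 k, advX (S.uAt j m) (S.U (k - j) i) m z
        + ∑ j ∈ Finset.Icc 1 k,
          (advX (S.UAt j m z) (S.U (k - j) i) m z + adv (S.UAt j m z) (S.u (k - j) i) m) := by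
    have h1 : ∑ q ∈ Finset.range (k + 1), advX (S.uAt q m) (S.U (k - q) i) m z
        = advX (S.uAt 0 m) (S.U k i) m z
          + ∑ j ∈ Finset.Ico 1 k, advX (S.uAt j m) (S.U (k - j) i) m z := by
      rw [Finset.sum_range_succ, Nat.sub_self, advX_of_eq_zero (hU0 i), add_zero]
      rcases Nat.eq_zero_or_pos k with rfl | hk
      · simp [advX_of_eq_zero (hU0 i)]
      · rw [Finset.range_eq_Ico, Finset.sum_eq_sum_Ico_succ_bot hk, Nat.sub_zero]
    have h2 : ∑ q ∈ Finset.range (k + 1),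
          (advX (S.UAt q m z) (S.U (k - q) i) m z + adv (S.UAt q m z) (S.u (k - q) i) m)
        = ∑ j ∈ Finset.Icc 1 k,
          (advX (S.UAt j m z) (S.U (k - j) i) m z + adv (S.UAt j m z) (S.u (k - j) i) m) := by
      rw [Finset.range_eq_Ico, Finset.sum_eq_sum_Ico_succ_bot (Nat.succ_pos k), hu0, hadv, hadvX,
        add_zero, zero_add]
      rfl
    rw [← h1, ← h2, ← Finset.sum_add_distrib]
    refine Finset.sum_congr rfl fun q _ => ?_
    rw [advX_add]
    ring
  have hsplit : ∑ q ∈ Finset.range (k + 1),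
        (advMic (S.uAt q m + S.UAt q m z) (S.U (k + 1 - q) i) m z
          + advX (S.uAt q m + S.UAt q m z) (S.U (k - q) i) m z
          + adv (S.UAt q m z) (S.u (k - q) i) m)
      = ∑ q ∈ Finset.range (k + 1), advMic (S.uAt q m + S.UAt q m z) (S.U (k + 1 - q) i) m z
        + ∑ q ∈ Finset.range (k + 1),
          (advX (S.uAt q m + S.UAt q m z) (S.U (k - q) i) m z
            + adv (S.UAt q m z) (S.u (k - q) i) m) := by
    rw [← Finset.sum_add_distrib]
    exact Finset.sum_congr rfl fun q _ => add_assoc _ _ _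
  rw [layerForce, layerRemainder, hsplit, hsum]
  simp only [explicitIntegrand]
  change -prm.Re * advX (S.uAt 0 m) (S.U k i) m z + (1 - prm.r) * lapX (S.U k i) m z
    - prm.Re * ∑ j ∈ Finset.Ico 1 k, advX (S.uAt j m) (S.U (k - j) i) m z
    - prm.Re * ∑ j ∈ Finset.Icc 1 k,
        (advX (S.UAt j m z) (S.U (k - j) i) m z + adv (S.UAt j m z) (S.u (k - j) i) m) = _
  ring

variable {prm : FlowParams} {H : (Fin d → ℝ) → ℝ} {f : Fin (d + 1) → MacroField d} {k : ℕ}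
  {S : Expansion d}

lemma IsElementarySystem.jointlySmooth_U (hS : S.IsElementarySystem prm H f k) {n : ℕ}
    (hn : n ≤ k + 1) (i : Fin (d + 1)) : JointlySmooth (S.U n i) := by
  rcases Nat.eq_zero_or_pos n with rfl | h
  · rw [show S.U 0 i = fun _ _ => 0 from funext₂ (hS.U_zero i)]
    exact jointlySmooth_zero
  · exact (hS.layer n h hn).smooth_U i

lemma IsElementarySystem.hasVanishingMean_advMic (hd : d = 1 ∨ d = 2) (hH : IsRoughness H)
    (hS : S.IsElementarySystem prm H f k) {m : Pt d} (hm : m ∈ closedStrip d) (i : Fin (d + 1))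
    {q n : ℕ} (hq : q ≤ k + 1) (hn : 1 ≤ n) (hnk : n ≤ k + 1) :
    HasVanishingMean fun z => advMic (S.uAt q m + S.UAt q m z) (S.U n i) m z := by
  have hL := hS.layer n hn hnk
  have hs := (hL.strong m hm).1 i
  have hv := (hS.jointlySmooth_U hnk i).slice m
  have h1 : HasVanishingMean fun z => ∑ p, S.u q p m * pd p (S.U n i m) z :=
    HasVanishingMean.sum _ fun p _ => HasVanishingMean.const_mul _
      ⟨contDiff_pd hv p, tendsto_torusInt_pd hH hv hs p⟩
  have h2 : HasVanishingMean fun z => ∑ p, S.U q p m z * pd p (S.U n i m) z := by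
    rcases Nat.eq_zero_or_pos q with rfl | h
    · simpa [hS.U_zero] using HasVanishingMean.zero
    · have hL' := hS.layer q h hq
      exact HasVanishingMean.transport hd hH (fun i => (hS.jointlySmooth_U hq i).slice m)
        (fun i => hL'.periodic_U i m) (hL'.incompressible m hm) (hL'.strong m hm).1 hv
        (hL.periodic_U i m) hs
  have h3 := h1.add h2
  simp only [← Finset.sum_add_distrib, ← add_mul] at h3
  exact h3

lemma IsElementarySystem.hasVanishingMean_layerRemainder (hd : d = 1 ∨ d = 2)
    (hH : IsRoughness H) (hS : S.IsElementarySystem prm H f k) {m : Pt d}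
    (hm : m ∈ closedStrip d) (i : Fin (d + 1)) :
    HasVanishingMean (S.layerRemainder prm k i m) := by
  have hL := hS.layer (k + 1) (Nat.succ_pos k) le_rfl
  have hT : ∀ j, JointlySmooth (S.Sig (k + 1) i j) := hL.smooth_Sig i
  have hP : JointlySmooth (S.P (k + 1)) := hL.smooth_P
  refine HasVanishingMean.sub (HasVanishingMean.add (HasVanishingMean.sub
    (HasVanishingMean.add ?_ ?_) ?_) ?_) ?_
  · exact HasVanishingMean.sum _ fun j _ => ⟨((hT j).pdMic j).slice m,
      tendsto_torusInt hH (((hT j).pdMic j).slice m) (((hL.strong m hm).2.2 i j).2 j)⟩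
  · exact HasVanishingMean.const_mul _
      (HasVanishingMean.mixedLap (hS.jointlySmooth_U le_rfl i) (hL.periodic_U i) m)
  · exact ⟨(hP.pdX i).slice m,
      tendsto_torusInt hH ((hP.pdX i).slice m) (hL.strong_x m hm i).2.1⟩
  · refine HasVanishingMean.sum _ fun j _ => ?_
    rcases Nat.eq_zero_or_pos k with rfl | h
    · rw [show S.Sig 0 i j = fun _ _ => 0 from funext₂ (hS.Sig_zero i j), pdX_zero]
      exact HasVanishingMean.zero
    · have hL' := hS.layer k h k.le_succ
      have hT' : JointlySmooth (S.Sig k i j) := hL'.smooth_Sig i j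
      have hs := (hL'.strong_x m hm j).2.2 i j
      -- The x-derivatives of Σ_k are in H²(Ω); only H¹(Ω) is used.
      exact ⟨(hT'.pdX j).slice m, tendsto_torusInt hH ((hT'.pdX j).slice m)
        ⟨hs.1, fun q => (hs.2 q).1⟩⟩
  -- Here q ≤ k, so the transported field U_{k+1-q} has order at least 1 and solves a boundary layer
  -- problem.
  · refine HasVanishingMean.const_mul _ (HasVanishingMean.sum _ fun q hq => ?_)
    have hq' := Finset.mem_range.1 hq
    exact hS.hasVanishingMean_advMic hd hH hm i (by omega) (by omega) (by omega)

/-- Regularity makes the slices integrable, which is needed to split the mean of a difference. -/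
lemma IsElementarySystem.contDiff_layerForce (hS : S.IsElementarySystem prm H f k) (m : Pt d)
    (i : Fin (d + 1)) : ContDiff ℝ ∞ (S.layerForce prm k i m) := by
  have hL := hS.layer (k + 1) (Nat.succ_pos k) le_rfl
  have hT : ∀ j, JointlySmooth (S.Sig (k + 1) i j) := hL.smooth_Sig i
  have hP : JointlySmooth (S.P (k + 1)) := hL.smooth_P
  have hU : ∀ {n : ℕ}, n ≤ k + 1 → ∀ i, JointlySmooth (S.U n i) := hS.jointlySmooth_U
  have hT' : ∀ j, JointlySmooth (S.Sig k i j) := fun j => by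
    rcases Nat.eq_zero_or_pos k with rfl | h
    · rw [show S.Sig 0 i j = fun _ _ => 0 from funext₂ (hS.Sig_zero i j)]
      exact jointlySmooth_zero
    · exact (hS.layer k h k.le_succ).smooth_Sig i j
  have hM : ContDiff ℝ ∞ (mixedLap (S.U (k + 1) i) m) :=
    ContDiff.sum fun q _ => (((hU le_rfl i).pdMic q).pdX q).slice m
  refine ContDiff.sub (ContDiff.add (ContDiff.sub (ContDiff.add (ContDiff.add ?_ ?_) ?_) ?_) ?_) ?_
  · exact ContDiff.sum fun j _ => ((hT j).pdMic j).slice m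
  · exact contDiff_const.mul hM
  · exact contDiff_const.mul ((hU k.le_succ i).lapX m)
  · exact (hP.pdX i).slice m
  · exact ContDiff.sum fun j _ => ((hT' j).pdX j).slice m
  · refine contDiff_const.mul (ContDiff.sum fun q hq => ?_)
    have hq' := Finset.mem_range.1 hq
    have hv : ∀ p, ContDiff ℝ ∞ fun z => S.UAt q m z p := fun p =>
      (hU (n := q) (by omega) p).slice m
    have hw : ∀ p, ContDiff ℝ ∞ fun z => (S.uAt q m + S.UAt q m z) p := fun p =>
      contDiff_const.add (hv p)
    refine ContDiff.add (ContDiff.add ?_ ?_) ?_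
    · exact (hU (by omega) i).advMic hw m
    · exact (hU (by omega) i).advX hw m
    · exact ContDiff.sum fun p _ => (hv p).mul contDiff_const

/-- The explicit formula for `a_k`. -/
lemma IsElementarySystem.tendsto_explicitIntegrand (hd : d = 1 ∨ d = 2) (hH : IsRoughness H)
    (hS : S.IsElementarySystem prm H f k) {m : Pt d} (hm : m ∈ closedStrip d) (i : Fin (d + 1)) :
    Tendsto (fun Y : ℝ => torusInt fun X => explicitIntegrand prm S.u S.U k i m (X, Y)) atTop
      (𝓝 (S.a k i m)) := by
  have hR := hS.hasVanishingMean_layerRemainder hd hH hm i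
  have hF := hS.contDiff_layerForce m i
  simp only [explicitIntegrand_eq prm S hS.U_zero,
    torusInt_sub (continuous_slice hF _) (continuous_slice hR.1 _)]
  simpa using (hS.compatible k le_rfl m hm i).sub hR.2

end Expansion

/-! ### Dependence of the explicit formula on the velocities -/

section locality

variable {d : ℕ} {s : Set (Pt d)}

lemma isOpen_omegaZero : IsOpen (omegaZero d) :=
  (isOpen_lt continuous_const continuous_snd).inter (isOpen_lt continuous_snd continuous_const)

/-- Openness lets equality of functions pass to derivatives, which is why the comparison of two
families is made on ω₀ and not on the closed strip. -/
lemma pd_congr_of_eqOn (hs : IsOpen s) {g h : Pt d → ℝ} (hgh : Set.EqOn g h s) (i : Fin (d + 1)) :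
    Set.EqOn (pd i g) (pd i h) s := fun m hm => by
  rw [pd, pd, (hgh.eventuallyEq_of_mem (hs.mem_nhds hm)).fderiv_eq]

lemma pdX_congr_of_eqOn (hs : IsOpen s) {V W : LayerField d} {z : Pt d}
    (hVW : ∀ m ∈ s, V m z = W m z) (i : Fin (d + 1)) : ∀ m ∈ s, pdX i V m z = pdX i W m z :=
  fun m hm => by
    simp only [pdX]
    rw [pd_congr_of_eqOn hs (g := fun m => V m z) (h := fun m => W m z) hVW i hm]

lemma advX_congr_of_eqOn (hs : IsOpen s) {V W : LayerField d} {z : Pt d}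
    (hVW : ∀ m ∈ s, V m z = W m z) {v w : Fin (d + 1) → ℝ} (hvw : v = w) {m : Pt d} (hm : m ∈ s) :
    advX v V m z = advX w W m z := by
  simp only [advX, hvw, pdX_congr_of_eqOn hs hVW _ m hm]

lemma lapX_congr_of_eqOn (hs : IsOpen s) {V W : LayerField d} {z : Pt d}
    (hVW : ∀ m ∈ s, V m z = W m z) {m : Pt d} (hm : m ∈ s) : lapX V m z = lapX W m z :=
  Finset.sum_congr rfl fun q _ =>
    pdX_congr_of_eqOn hs (pdX_congr_of_eqOn hs hVW q) q m hm

lemma explicitIntegrand_congr (prm : FlowParams) (hs : IsOpen s) {z : Pt d} {k : ℕ}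
    {u u' : ℕ → Fin (d + 1) → MacroField d} {U U' : ℕ → Fin (d + 1) → LayerField d}
    (hU0 : ∀ i m, U 0 i m z = 0) (hu : ∀ n < k, ∀ i, ∀ m ∈ s, u' n i m = u n i m)
    (hU : ∀ n ≤ k, ∀ i, ∀ m ∈ s, U' n i m z = U n i m z) {m : Pt d} (hm : m ∈ s)
    (i : Fin (d + 1)) :
    explicitIntegrand prm u' U' k i m z = explicitIntegrand prm u U k i m z := by
  -- For k = 0 nothing is assumed about u_0, but it multiplies ∇_x U_0 = 0.
  have h0 : advX (fun q => u' 0 q m) (U' k i) m z = advX (fun q => u 0 q m) (U k i) m z := by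
    rcases Nat.eq_zero_or_pos k with rfl | hk
    · have hz : ∀ q, pdX q (U 0 i) m z = 0 := fun q => by simp [pdX, pd, hU0]
      simp [advX, pdX_congr_of_eqOn hs (hU 0 le_rfl i) _ m hm, hz]
    · exact advX_congr_of_eqOn hs (hU k le_rfl i) (funext fun q => hu 0 hk q m hm) hm
  simp only [explicitIntegrand]
  rw [h0, lapX_congr_of_eqOn hs (hU k le_rfl i) hm]
  congr 2
  · congr 1
    refine Finset.sum_congr rfl fun j hj => ?_
    have hj' := (Finset.mem_Ico.1 hj).2
    exact advX_congr_of_eqOn hs (hU (k - j) (by omega) i) (funext fun q => hu j hj' q m hm) hm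
  · refine Finset.sum_congr rfl fun j hj => ?_
    have hj' := Finset.mem_Icc.1 hj
    have hv : (fun q => U' j q m z) = fun q => U j q m z := funext fun q => hU j hj'.2 q m hm
    rw [advX_congr_of_eqOn hs (hU (k - j) (by omega) i) hv hm, hv]
    simp only [adv, pd_congr_of_eqOn hs (hu (k - j) (by omega) i) _ hm]

end locality

theorem proposition6 (d : ℕ) (hd : d = 1 ∨ d = 2) (prm : FlowParams)
    (H : (Fin d → ℝ) → ℝ) (hH : IsRoughness H) (f : Fin (d + 1) → MacroField d)
    (k : ℕ) (S : Expansion d) (hS : S.IsElementarySystem prm H f k) :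
    (∀ m ∈ closedStrip d, ∀ i,
      Tendsto (fun Y : ℝ => torusInt fun X => explicitIntegrand prm S.u S.U k i m (X, Y)) atTop
        (𝓝 (S.a k i m))) ∧
    (∀ S' : Expansion d, S'.IsElementarySystem prm H f k →
      (∀ n < k, ∀ i, ∀ m ∈ omegaZero d, S'.u n i m = S.u n i m) →
      (∀ n ≤ k, ∀ i, ∀ m ∈ omegaZero d, ∀ z ∈ layerDomain H, S'.U n i m z = S.U n i m z) →
      ∀ m ∈ omegaZero d, ∀ i, S'.a k i m = S.a k i m) := by
  refine ⟨fun m hm i => hS.tendsto_explicitIntegrand hd hH hm i,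
    fun S' hS' hu hU m hm i => ?_⟩
  have hm' : m ∈ closedStrip d := ⟨hm.1.le, hm.2.le⟩
  refine tendsto_nhds_unique (hS'.tendsto_explicitIntegrand hd hH hm' i)
    ((hS.tendsto_explicitIntegrand hd hH hm' i).congr' ?_)
  -- The correctors are only known to agree on Ω, which contains every slice with Y > 0.
  filter_upwards [eventually_gt_atTop 0] with Y hY
  congr 1
  ext X
  have hz : (X, Y) ∈ layerDomain H := lt_trans (neg_lt_zero.2 (hH.pos X)) hY
  exact (explicitIntegrand_congr prm isOpen_omegaZero (fun i m => hS.U_zero i m _) hu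
    (fun n hn i m hm => hU n hn i m hm _ hz) hm i).symm
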